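/- Threshold testing: $n\ge 1$ boxes contain values $X_1,\dots,X_n\ge 0$ drawn i.i.d. from a known finite discrete distribution $F$ with support $v_1<\dots<v_m$. An algorithm tests the boxes $1,\dots,n$ in this order, each exactly once; for box $i$ it chooses a threshold $t_i\ge 0$, depending on the earlier feedback and on internal randomness independent of the $X_i$, and learns only whether $X_i\ge t_i$. After all $n$ tests it chooses a box $\sigma$, based on the feedback and its internal randomness, and receives $X_\sigma$. It is $c$-competitive if $\mathbb{E}[X_\sigma]\ge c\cdot\mathbb{E}[\max\{X_1,\dots,X_n\}]$, and optimal for $(n,F)$ if no such algorithm has a larger $\mathbb{E}[X_\sigma]$. Consider the dynamic programming algorithm given by backward induction: put $W_0(V)=V$ and $$W_{k+1}(V)=\max_{1\le j\le m}\Big(\Pr[X\ge v_j]\,W_k\big(\max\{V,\mathbb{E}[X\mid X\ge v_j]\}\big)+\Pr[X<v_j]\,W_k\big(\max\{V,\mathbb{E}[X\mid X<v_j]\}\big)\Big),$$ where a term of probability $0$ is read as $0$. When $k+1$ boxes are still untested and $V$ is the largest conditional expectation of a tested box given its test result ($V=0$ before the first test), the algorithm tests the next box for a value $v_j$ attaining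 the maximum; at the end it chooses a box with the largest conditional expectation. Corollary 7. This dynamic programming algorithm is optimal for every $n\ge1$ and every finite discrete distribution $F$. Moreover, there is a function $\varepsilon:\mathbb{N}\to\mathbb{R}$ with $\varepsilon(n)\to 0$ as $n\to\infty$, not depending on the distribution, such that for every $n\ge1$ and every finite discrete distribution $F$ on $[0,\infty)$, every optimal algorithm for $(n,F)$, and hence the dynamic programming algorithm, is $(0.869-\varepsilon(n))$-competitive. -/

import Mathlib

open Filter Topology MeasureTheory
open scoped NNReal BigOperators

namespace ThresholdTesting

noncomputable section

/-- A finite discrete distribution on the nonnegative reals: its support `v₁ < ⋯ < vₘ`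
together with the (positive) probabilities of these values. -/
structure FiniteDistribution where
  /-- number of distinct realizations -/
  m : ℕ
  /-- the realizations, in increasing order -/
  val : Fin m → ℝ≥0
  /-- their probabilities -/
  prob : Fin m → ℝ
  strictMono_val : StrictMono val
  prob_pos : ∀ j, 0 < prob j
  sum_prob : ∑ j, prob j = 1

namespace FiniteDistribution

variable (F : FiniteDistribution)

theorem nonempty_index : Nonempty (Fin F.m) := by
  by_contra h
  rw [not_nonempty_iff] at h
  have := F.sum_prob
  simp at this

/-- `𝔼[f(X₁,…,Xₙ)]` for `X₁,…,Xₙ` drawn i.i.d. from `F`. -/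
def expect (n : ℕ) (f : (Fin n → ℝ≥0) → ℝ) : ℝ :=
  ∑ x : Fin n → Fin F.m, (∏ i, F.prob (x i)) * f (fun i => F.val (x i))

/-- `𝔼[max{X₁,…,Xₙ}]`. -/
def expectedMax (n : ℕ) : ℝ :=
  F.expect n fun x => ((Finset.univ.sup x : ℝ≥0) : ℝ)

/-- The probability that the test of a single box with threshold `t` has result `b`
(`true`: positive, i.e. `X ≥ t`; `false`: negative, i.e. `X < t`). -/
def testProb (t : ℝ≥0) (b : Bool) : ℝ :=
  ∑ j, if decide (t ≤ F.val j) = b then F.prob j else 0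

/-- The conditional expectation of the value of a box, given that its test with threshold `t`
has result `b`. (It is only relevant for results of positive probability.) -/
def condExpectation (t : ℝ≥0) (b : Bool) : ℝ :=
  (∑ j, if decide (t ≤ F.val j) = b then F.prob j * (F.val j : ℝ) else 0) / F.testProb t b

end FiniteDistribution

/-- A deterministic threshold testing algorithm for `n` boxes. Boxes are tested in the order
`0, …, n-1`, each exactly once. The feedback received so far is recorded as a list of Booleans,
the most recent result first. `threshold h` is the threshold of the next test after feedback `h`,
and `select h` is the box that is chosen after the complete feedback `h`. -/
structure DetAlgorithm (n : ℕ) where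
  threshold : List Bool → ℝ≥0
  select : List Bool → Fin n

namespace DetAlgorithm

variable {n : ℕ}

/-- The feedback of all `n` tests (most recent first) if the boxes contain `x`. -/
def feedback (A : DetAlgorithm n) (x : Fin n → ℝ≥0) : List Bool :=
  (List.ofFn x).foldl (fun h y => decide (A.threshold h ≤ y) :: h) []

/-- The reward `X_σ` if the boxes contain `x`. -/
def reward (A : DetAlgorithm n) (x : Fin n → ℝ≥0) : ℝ :=
  x (A.select (A.feedback x))

/-- `𝔼[X_σ]`. -/
def expectedReward (A : DetAlgorithm n) (F : FiniteDistribution) : ℝ :=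
  F.expect n A.reward

end DetAlgorithm

/-- A (randomized) threshold testing algorithm for `n` boxes: the internal randomness is a seed
from a probability space, drawn independently of the boxes; all decisions may depend on it. -/
structure TestingAlgorithm (n : ℕ) where
  Seed : Type
  [measurableSpace : MeasurableSpace Seed]
  law : Measure Seed
  [isProbabilityMeasure : IsProbabilityMeasure law]
  alg : Seed → DetAlgorithm n
  measurable_threshold : ∀ h, Measurable fun ω => (alg ω).threshold h
  measurable_select : ∀ h, Measurable fun ω => (alg ω).select h

attribute [instance] TestingAlgorithm.measurableSpace TestingAlgorithm.isProbabilityMeasure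

namespace TestingAlgorithm

variable {n : ℕ}

/-- `𝔼[X_σ]`, over the boxes and the internal randomness. -/
def expectedReward (A : TestingAlgorithm n) (F : FiniteDistribution) : ℝ :=
  ∫ ω, (A.alg ω).expectedReward F ∂A.law

/-- `A` is `c`-competitive on `F`: `𝔼[X_σ] ≥ c · 𝔼[max{X₁,…,Xₙ}]`. -/
def IsCompetitive (A : TestingAlgorithm n) (F : FiniteDistribution) (c : ℝ) : Prop :=
  c * F.expectedMax n ≤ A.expectedReward F

/-- `A` is optimal for `F`: no threshold testing algorithm, deterministic or randomized, with
arbitrary thresholds, has a larger expected reward. -/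
def IsOptimal (A : TestingAlgorithm n) (F : FiniteDistribution) : Prop :=
  ∀ B : TestingAlgorithm n, B.expectedReward F ≤ A.expectedReward F

/-- A deterministic algorithm, seen as a randomized one with trivial randomness. -/
def ofDet (A : DetAlgorithm n) : TestingAlgorithm n where
  Seed := Unit
  law := Measure.dirac ()
  alg := fun _ => A
  measurable_threshold := fun _ => measurable_const
  measurable_select := fun _ => measurable_const

end TestingAlgorithm

namespace FiniteDistribution

variable (F : FiniteDistribution)

/-- Bellman step: if the best conditional expectation among the boxes tested so far is `V`, and
`W` maps the best conditional expectation after the next test to the expected final reward, then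
this is the expected final reward when the next box is tested for the realization `v_j`. -/
def stepValue (W : ℝ → ℝ) (V : ℝ) (j : Fin F.m) : ℝ :=
  ∑ b : Bool, F.testProb (F.val j) b * W (max V (F.condExpectation (F.val j) b))

/-- Table of the dynamic program: the optimal expected final reward when `k` boxes are still to be
tested and the best conditional expectation so far is `V`. -/
def dpValue : ℕ → ℝ → ℝ
  | 0, V => V
  | k + 1, V => ⨆ j, F.stepValue (dpValue k) V j

theorem exists_dpTest (k : ℕ) (V : ℝ) :
    ∃ j, ∀ i, F.stepValue (F.dpValue k) V i ≤ F.stepValue (F.dpValue k) V j :=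
  haveI := F.nonempty_index
  Finite.exists_max _

/-- The decision of the dynamic program: (the index of) a best realization to test the next box
for, if `k` further boxes come after it and the best conditional expectation so far is `V`. -/
def dpTest (k : ℕ) (V : ℝ) : Fin F.m :=
  (F.exists_dpTest k V).choose

/-- State of the dynamic programming algorithm for `n` boxes after feedback `h` (most recent
first): the best conditional expectation among the tested boxes, and a box attaining it.
Before the first test the value is `0`, which is at most every conditional expectation. -/
def dpState (n : ℕ) : List Bool → ℝ × ℕ
  | [] => (0, 0)
  | b :: h =>
    let s := dpState n h
    let e := F.condExpectation (F.val (F.dpTest (n - 1 - h.length) s.1)) b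
    if s.1 < e then (e, h.length) else s

/-- The algorithm computed by the dynamic program: test each box for the realization recorded in
the table, and finally choose the box with the best conditional expectation. -/
def dpAlgorithm (n : ℕ) [NeZero n] : DetAlgorithm n where
  threshold := fun h => F.val (F.dpTest (n - 1 - h.length) (F.dpState n h).1)
  select := fun h => Fin.ofNat n (F.dpState n h).2

end FiniteDistribution

end

end ThresholdTesting

/-! Given the feedback, the chosen box is worth its own conditional expectation, which depends only
on its own test, so the best conditional expectation so far is a sufficient state. `expect_affine`
turns the expected reward into an average over the feedback tree; Bellman induction bounds that
average by `dpValue n 0`, and the dynamic program attains this bound. Averaging over seeds gains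
nothing.

For the ratio, `dpValue n 0` is bounded from below by one explicit strategy. Since `dpValue` is
monotone and convex in the current best value, it dominates tests at arbitrary quantiles, although
the distribution has atoms (`quantile_mix_le`). The strategy cuts the boxes into twelve equal
blocks, tests each block at its own quantile, and after the first success spends the later blocks on
a smaller quantile. Its payoff bound and the expected maximum are both linear in the increments of
the support, which are nonnegative, so they need to be compared only for a single tail probability
`g` (`mul_expectedMax_le_dpValue`).

With `θ = n * g` the payoff is a concave function of `θ` (`stepScore`), while `(1 - g) ^ n` is
bounded below, for large `n`, by slightly lowered tangents of `exp (-θ)`. A concave function lies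
above an affine one on an interval as soon as it does so at the endpoints (`line_le_stepScore`),
which leaves finitely many rational inequalities. Nothing here depends on the distribution, so one
`N` serves all of them. -/

namespace ThresholdTesting

noncomputable section

/-! ### A single test and its conditional expectations. -/

namespace FiniteDistribution

variable (F : FiniteDistribution)

theorem expect_zero (f : (Fin 0 → ℝ≥0) → ℝ) : F.expect 0 f = f Fin.elim0 := by
  simp only [expect, Finset.univ_unique, Finset.univ_eq_empty, Finset.prod_empty, one_mul,
    Finset.sum_singleton]
  congr 1
  exact Subsingleton.elim _ _

theorem expect_succ (n : ℕ) (f : (Fin (n + 1) → ℝ≥0) → ℝ) :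
    F.expect (n + 1) f =
      ∑ j, F.prob j * F.expect n fun x => f (Fin.cons (F.val j) x) := by
  simp only [expect]
  rw [← (Fin.consEquiv fun _ : Fin (n + 1) => Fin F.m).sum_comp, Fintype.sum_prod_type]
  refine Finset.sum_congr rfl fun j _ => ?_
  rw [Finset.mul_sum]
  refine Finset.sum_congr rfl fun x _ => ?_
  have h : (fun i => F.val ((Fin.consEquiv fun _ : Fin (n + 1) => Fin F.m) (j, x) i)) =
      (Fin.cons (F.val j) fun i => F.val (x i) : Fin (n + 1) → ℝ≥0) := by
    funext i
    refine Fin.cases ?_ (fun i => ?_) i <;> simp [Fin.consEquiv]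
  rw [h, Fin.prod_univ_succ]
  simp [Fin.consEquiv, mul_assoc]

theorem testProb_nonneg (t : ℝ≥0) (b : Bool) : 0 ≤ F.testProb t b :=
  Finset.sum_nonneg fun j _ => by split_ifs <;> simp [(F.prob_pos j).le]

theorem condExpectation_nonneg (t : ℝ≥0) (b : Bool) : 0 ≤ F.condExpectation t b := by
  refine div_nonneg (Finset.sum_nonneg fun j _ => ?_) (F.testProb_nonneg t b)
  split_ifs
  · exact mul_nonneg (F.prob_pos j).le (NNReal.coe_nonneg _)
  · exact le_rfl

/-- A result of probability zero does no harm: the partial sum on the right then vanishes too,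
whatever the quotient by zero is. -/
theorem testProb_mul_condExpectation (t : ℝ≥0) (b : Bool) :
    F.testProb t b * F.condExpectation t b =
      ∑ j, if decide (t ≤ F.val j) = b then F.prob j * (F.val j : ℝ) else 0 := by
  by_cases h : F.testProb t b = 0
  · rw [h, zero_mul]
    refine (Finset.sum_eq_zero fun j _ => ?_).symm
    have := (Finset.sum_eq_zero_iff_of_nonneg fun j _ => by
      split_ifs <;> simp [(F.prob_pos j).le]).1 h j (Finset.mem_univ j)
    split_ifs with hj
    · rw [if_pos hj] at this
      simp [this]
    · rfl
  · rw [condExpectation, mul_div_cancel₀ _ h]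

theorem sum_testProb (t : ℝ≥0) : F.testProb t true + F.testProb t false = 1 := by
  rw [testProb, testProb, ← Finset.sum_add_distrib, ← F.sum_prob]
  refine Finset.sum_congr rfl fun j _ => ?_
  by_cases h : t ≤ F.val j <;> simp [h]

/-- The expectation of an affine function of the value of a box whose coefficients depend on the
test result can be computed with the conditional expectations. -/
theorem sum_prob_mul_affine (t : ℝ≥0) (α β : Bool → ℝ) :
    ∑ j, F.prob j * (α (decide (t ≤ F.val j)) + F.val j * β (decide (t ≤ F.val j))) =
      ∑ b, F.testProb t b * (α b + F.condExpectation t b * β b) := by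
  have h : ∀ b, F.testProb t b * (α b + F.condExpectation t b * β b) =
      ∑ j, if decide (t ≤ F.val j) = b then F.prob j * (α b + F.val j * β b) else 0 := by
    intro b
    rw [mul_add, ← mul_assoc, testProb_mul_condExpectation, testProb, Finset.sum_mul,
      Finset.sum_mul, ← Finset.sum_add_distrib]
    refine Finset.sum_congr rfl fun j _ => ?_
    split_ifs <;> ring
  simp only [h]
  rw [Finset.sum_comm]
  refine Finset.sum_congr rfl fun j _ => ?_
  rw [Finset.sum_ite_eq]
  simp

end FiniteDistribution

/-! ### The expected reward as an average over the feedback tree. -/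

namespace DetAlgorithm

variable {n : ℕ} (A : DetAlgorithm n) (F : FiniteDistribution)

/-- The feedback after the tests of further boxes with contents `x`, starting from feedback `h`. -/
def feedbackFrom (h : List Bool) {k : ℕ} (x : Fin k → ℝ≥0) : List Bool :=
  (List.ofFn x).foldl (fun h y => decide (A.threshold h ≤ y) :: h) h

/-- The expectation of `Φ` at the feedback after `k` further tests, starting from feedback `h`. -/
def treeValue : ℕ → List Bool → (List Bool → ℝ) → ℝ
  | 0, h, Φ => Φ h
  | k + 1, h, Φ => ∑ b, F.testProb (A.threshold h) b * treeValue k (b :: h) Φ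

/-- The conditional expectation of the `i`-th box given the feedback. -/
def boxExpectation : List Bool → ℕ → ℝ
  | [], _ => 0
  | b :: h, i =>
    if i = h.length then F.condExpectation (A.threshold h) b else boxExpectation h i

theorem boxExpectation_append (l : List Bool) (b : Bool) (h : List Bool) :
    A.boxExpectation F (l ++ b :: h) h.length = F.condExpectation (A.threshold h) b := by
  induction l with
  | nil => simp [boxExpectation]
  | cons c l ih =>
    rw [List.cons_append, boxExpectation, if_neg, ih]
    simp
    omega

theorem treeValue_mono {k : ℕ} {h : List Bool} {Φ Ψ : List Bool → ℝ}
    (H : ∀ l : List Bool, l.length = k → Φ (l ++ h) ≤ Ψ (l ++ h)) :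
    A.treeValue F k h Φ ≤ A.treeValue F k h Ψ := by
  induction k generalizing h with
  | zero => exact H [] rfl
  | succ k ih =>
    refine Finset.sum_le_sum fun b _ => mul_le_mul_of_nonneg_left (ih fun l hl => ?_)
      (F.testProb_nonneg _ _)
    have := H (l ++ [b]) (by simp [hl])
    simpa using this

theorem treeValue_congr {k : ℕ} {h : List Bool} {Φ Ψ : List Bool → ℝ}
    (H : ∀ l : List Bool, l.length = k → Φ (l ++ h) = Ψ (l ++ h)) :
    A.treeValue F k h Φ = A.treeValue F k h Ψ :=
  le_antisymm (A.treeValue_mono F fun l hl => (H l hl).le)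
    (A.treeValue_mono F fun l hl => (H l hl).ge)

theorem treeValue_add_mul (k : ℕ) (h : List Bool) (c : ℝ) (Φ Ψ : List Bool → ℝ) :
    A.treeValue F k h (fun g => Φ g + c * Ψ g) =
      A.treeValue F k h Φ + c * A.treeValue F k h Ψ := by
  induction k generalizing h with
  | zero => rfl
  | succ k ih =>
    simp only [treeValue, ih, Finset.mul_sum, ← Finset.sum_add_distrib]
    exact Finset.sum_congr rfl fun _ _ => by ring

theorem feedbackFrom_cons (h : List Bool) {k : ℕ} (y : ℝ≥0) (x : Fin k → ℝ≥0) :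
    A.feedbackFrom h (Fin.cons y x : Fin (k + 1) → ℝ≥0) =
      A.feedbackFrom (decide (A.threshold h ≤ y) :: h) x := by
  simp [feedbackFrom, List.ofFn_succ]

/-- A payoff that is affine in the contents of the untested boxes, with coefficients depending on
the feedback, can be computed with the conditional expectations. -/
theorem expect_affine (k : ℕ) (h : List Bool) (u : List Bool → ℝ) (w : ℕ → List Bool → ℝ) :
    F.expect k (fun x => u (A.feedbackFrom h x) +
        ∑ i : Fin k, x i * w i (A.feedbackFrom h x)) =
      A.treeValue F k h fun g => u g +
        ∑ i : Fin k, A.boxExpectation F g (h.length + i) * w i g := by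
  induction k generalizing h u w with
  | zero => simp [F.expect_zero, treeValue, feedbackFrom]
  | succ k ih =>
    rw [F.expect_succ]
    simp only [feedbackFrom_cons, Fin.sum_univ_succ, Fin.cons_zero, Fin.cons_succ, Fin.val_succ,
      Fin.val_zero]
    -- Once the first box contains `c`, the term `c * w 0` joins the constant part, so the induction
    -- hypothesis applies. The outcome is affine in `c` with coefficients depending only on the test
    -- result, as `sum_prob_mul_affine` requires.
    have key : ∀ (b : Bool) (c : ℝ), F.expect k (fun x =>
          u (A.feedbackFrom (b :: h) x) + (c * w 0 (A.feedbackFrom (b :: h) x) +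
            ∑ i : Fin k, x i * w (i + 1) (A.feedbackFrom (b :: h) x))) =
        A.treeValue F k (b :: h) (fun g => u g +
          ∑ i : Fin k, A.boxExpectation F g ((b :: h).length + i) * w (i + 1) g) +
        c * A.treeValue F k (b :: h) (w 0) := by
      intro b c
      rw [← treeValue_add_mul]
      have := ih (b :: h) (fun g => u g + c * w 0 g) (fun i => w (i + 1))
      simp only [add_assoc] at this ⊢
      rw [this]
      congr 1
      funext g
      ring
    simp only [key]
    rw [F.sum_prob_mul_affine (A.threshold h) (fun b => A.treeValue F k (b :: h) (fun g => u g +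
          ∑ i : Fin k, A.boxExpectation F g ((b :: h).length + i) * w (i + 1) g))
        (fun b => A.treeValue F k (b :: h) (w 0))]
    refine Finset.sum_congr rfl fun b _ => ?_
    rw [← treeValue_add_mul]
    congr 1
    refine A.treeValue_congr F fun l _ => ?_
    rw [Nat.add_zero, A.boxExpectation_append F l b h]
    have : ∀ i : Fin k, (b :: h).length + (i : ℕ) = h.length + (i + 1) := fun i => by
      simp; omega
    simp only [this]
    ring

/-- The reward is affine in the contents: the coefficient of a box is the indicator that it is
selected. -/
theorem expectedReward_eq_treeValue :
    A.expectedReward F =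
      A.treeValue F n [] fun g => A.boxExpectation F g (A.select g) := by
  have := A.expect_affine F n [] (fun _ => 0)
    (fun i g => if i = (A.select g : ℕ) then 1 else 0)
  simp only [mul_ite, mul_one, mul_zero, zero_add, Fin.val_inj, Finset.sum_ite_eq',
    Finset.mem_univ, if_true, List.length_nil] at this
  exact this

/-- The largest conditional expectation of a tested box (and at least `0`). -/
def bestExpectation : List Bool → ℝ
  | [] => 0
  | b :: h => max (bestExpectation h) (F.condExpectation (A.threshold h) b)

theorem boxExpectation_le (h : List Bool) (i : ℕ) :
    A.boxExpectation F h i ≤ A.bestExpectation F h := by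
  induction h with
  | nil => exact le_rfl
  | cons b h ih =>
    rw [boxExpectation, bestExpectation]
    split_ifs
    · exact le_max_right _ _
    · exact le_max_of_le_left ih

end DetAlgorithm

/-! ### The Bellman upper bound for deterministic algorithms. -/

namespace FiniteDistribution

variable (F : FiniteDistribution)

theorem stepValue_le_dpValue_succ (k : ℕ) (V : ℝ) (j : Fin F.m) :
    F.stepValue (F.dpValue k) V j ≤ F.dpValue (k + 1) V :=
  le_ciSup (f := fun j => F.stepValue (F.dpValue k) V j) (Set.finite_range _).bddAbove j

theorem dpValue_succ (k : ℕ) (V : ℝ) :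
    F.dpValue (k + 1) V = F.stepValue (F.dpValue k) V (F.dpTest k V) := by
  have := F.nonempty_index
  exact le_antisymm (ciSup_le fun i => (F.exists_dpTest k V).choose_spec i)
    (F.stepValue_le_dpValue_succ k V _)

/-- Thresholds outside of the support do not help. -/
theorem sum_testProb_mul_le_dpValue_succ (k : ℕ) (V : ℝ) (t : ℝ≥0) :
    ∑ b, F.testProb t b * F.dpValue k (max V (F.condExpectation t b)) ≤ F.dpValue (k + 1) V := by
  by_cases h : ∃ i, t ≤ F.val i
  -- The least realization that is at least `t` defines the same test as `t`.
  · obtain ⟨j, hj, hmin⟩ := (Set.finite_univ.subset (Set.subset_univ {i | t ≤ F.val i})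
      ).exists_minimal h
    refine le_trans (le_of_eq ?_) (F.stepValue_le_dpValue_succ k V j)
    have : ∀ i, t ≤ F.val i ↔ F.val j ≤ F.val i := fun i => by
      refine ⟨fun hi => F.strictMono_val.monotone ?_, fun hi => le_trans hj hi⟩
      rcases le_total j i with h | h
      · exact h
      · exact hmin hi h
    simp only [stepValue, testProb, condExpectation, this]
  -- A threshold above the support always fails and the least realization always succeeds; both
  -- tests are uninformative and give the same value.
  · push Not at h
    have := F.nonempty_index
    obtain ⟨j, hj⟩ := Finite.exists_min F.val
    refine le_trans (le_of_eq ?_) (F.stepValue_le_dpValue_succ k V j)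
    have h' : ∀ i, ¬ t ≤ F.val i := fun i => not_le.2 (h i)
    simp [stepValue, testProb, condExpectation, h', hj]

end FiniteDistribution

namespace DetAlgorithm

variable {n : ℕ} (A : DetAlgorithm n) (F : FiniteDistribution)

theorem treeValue_bestExpectation_le (k : ℕ) (h : List Bool) :
    A.treeValue F k h (A.bestExpectation F) ≤ F.dpValue k (A.bestExpectation F h) := by
  induction k generalizing h with
  | zero => exact le_rfl
  | succ k ih =>
    refine le_trans (Finset.sum_le_sum fun b _ => mul_le_mul_of_nonneg_left (ih (b :: h))
      (F.testProb_nonneg _ _)) ?_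
    exact F.sum_testProb_mul_le_dpValue_succ k _ _

theorem expectedReward_le_dpValue : A.expectedReward F ≤ F.dpValue n 0 := by
  rw [expectedReward_eq_treeValue]
  exact (A.treeValue_mono F fun l _ => A.boxExpectation_le F _ _).trans
    (A.treeValue_bestExpectation_le F n [])

end DetAlgorithm

/-! ### The dynamic program attains its table value. -/

namespace FiniteDistribution

variable (F : FiniteDistribution)

theorem dpState_cons_fst (n : ℕ) [NeZero n] (b : Bool) (h : List Bool) :
    (F.dpState n (b :: h)).1 = max (F.dpState n h).1
      (F.condExpectation ((F.dpAlgorithm n).threshold h) b) := by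
  simp only [dpState, dpAlgorithm]
  split_ifs with hlt
  · exact (max_eq_right hlt.le).symm
  · exact (max_eq_left (not_lt.1 hlt)).symm

theorem dpState_snd_lt (n : ℕ) (b : Bool) (h : List Bool) :
    (F.dpState n (b :: h)).2 < (b :: h).length := by
  have key : ∀ (P : Prop) [Decidable P] (e : ℝ) (s : ℝ × ℕ), s.2 < h.length + 1 →
      (if P then (e, h.length) else s).2 < h.length + 1 := by
    intro P _ e s hs
    split_ifs
    · exact Nat.lt_succ_self _
    · exact hs
  induction h generalizing b with
  | nil => exact key _ _ _ Nat.one_pos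
  | cons c h ih =>
    -- `key` mentions `h`, so the induction hypothesis takes its instance for the shorter list as an
    -- argument.
    refine key _ _ _ ((ih c fun P _ e s hs => ?_).trans (Nat.lt_succ_self _))
    split_ifs
    · exact Nat.lt_succ_self _
    · exact hs

/-- At least one result is present because the initial state names box `0` before it is tested.
After one test that name is right even without an update, since then the conditional expectation is
`0`. -/
theorem boxExpectation_dpState (n : ℕ) [NeZero n] (b : Bool) (h : List Bool) :
    (F.dpAlgorithm n).boxExpectation F (b :: h) (F.dpState n (b :: h)).2 =
      (F.dpState n (b :: h)).1 := by
  induction h generalizing b with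
  | nil =>
    have h0 := F.condExpectation_nonneg ((F.dpAlgorithm n).threshold []) b
    rw [dpState_cons_fst]
    have : (F.dpState n [b]).2 = 0 := by simpa using F.dpState_snd_lt n b []
    rw [this]
    simp [DetAlgorithm.boxExpectation, dpState, h0]
  | cons c h ih =>
    by_cases hlt : (F.dpState n (c :: h)).1 <
        F.condExpectation (F.val (F.dpTest (n - 1 - (c :: h).length) (F.dpState n (c :: h)).1)) b
    · have : F.dpState n (b :: c :: h) = (F.condExpectation (F.val (F.dpTest
          (n - 1 - (c :: h).length) (F.dpState n (c :: h)).1)) b, (c :: h).length) := by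
        rw [dpState]; exact if_pos hlt
      rw [this, DetAlgorithm.boxExpectation, if_pos rfl]
      rfl
    · have : F.dpState n (b :: c :: h) = F.dpState n (c :: h) := by
        rw [dpState]; exact if_neg hlt
      rw [this, DetAlgorithm.boxExpectation, if_neg (F.dpState_snd_lt n c h).ne, ih]

theorem treeValue_dpState (n : ℕ) [NeZero n] (k : ℕ) (h : List Bool) (hk : h.length + k = n) :
    (F.dpAlgorithm n).treeValue F k h (fun g => (F.dpState n g).1) =
      F.dpValue k (F.dpState n h).1 := by
  induction k generalizing h with
  | zero => rfl
  | succ k ih =>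
    rw [dpValue_succ, DetAlgorithm.treeValue, stepValue]
    refine Finset.sum_congr rfl fun b _ => ?_
    have hn : n - 1 - h.length = k := by omega
    rw [ih (b :: h) (by simp; omega), dpState_cons_fst]
    simp only [dpAlgorithm, hn]

theorem expectedReward_dpAlgorithm (n : ℕ) [NeZero n] :
    (F.dpAlgorithm n).expectedReward F = F.dpValue n 0 := by
  rw [DetAlgorithm.expectedReward_eq_treeValue]
  refine Eq.trans ?_ (F.treeValue_dpState n n [] (by simp))
  refine DetAlgorithm.treeValue_congr _ F fun l hl => ?_
  rw [List.append_nil]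
  cases l with
  | nil => exact absurd hl.symm (NeZero.ne n)
  | cons b h =>
    rw [← boxExpectation_dpState]
    congr 1
    have := F.dpState_snd_lt n b h
    rw [hl] at this
    simp [dpAlgorithm, Fin.ofNat, Nat.mod_eq_of_lt this]

/-- One can always keep the current box. At `V = 0` this gives nonnegativity of the table. -/
theorem le_dpValue (k : ℕ) (V : ℝ) : V ≤ F.dpValue k V := by
  induction k generalizing V with
  | zero => exact le_rfl
  | succ k ih =>
    rw [dpValue_succ]
    generalize F.dpTest k V = j
    have h : ∀ b, V ≤ F.dpValue k (max V (F.condExpectation (F.val j) b)) := fun b =>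
      (le_max_left _ _).trans (ih _)
    rw [stepValue, Fintype.sum_bool]
    have h1 := mul_le_mul_of_nonneg_left (h true) (F.testProb_nonneg (F.val j) true)
    have h2 := mul_le_mul_of_nonneg_left (h false) (F.testProb_nonneg (F.val j) false)
    have h3 := F.sum_testProb (F.val j)
    calc V = (F.testProb (F.val j) true + F.testProb (F.val j) false) * V := by rw [h3, one_mul]
      _ ≤ _ := by linarith

end FiniteDistribution

/-! ### Randomized algorithms. -/

namespace TestingAlgorithm

variable {n : ℕ}

theorem expectedReward_le_dpValue (B : TestingAlgorithm n) (F : FiniteDistribution) :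
    B.expectedReward F ≤ F.dpValue n 0 := by
  by_cases h : Integrable (fun ω => (B.alg ω).expectedReward F) B.law
  · calc B.expectedReward F ≤ ∫ _, F.dpValue n 0 ∂B.law :=
          integral_mono h (integrable_const _) fun ω => (B.alg ω).expectedReward_le_dpValue F
      _ = F.dpValue n 0 := by simp
  -- Without integrability the Bochner integral is `0` by convention.
  · rw [expectedReward, integral_undef h]
    exact F.le_dpValue n 0

theorem expectedReward_ofDet (A : DetAlgorithm n) (F : FiniteDistribution) :
    (ofDet A).expectedReward F = A.expectedReward F := by
  exact integral_dirac (fun _ : Unit => A.expectedReward F) ()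

theorem isOptimal_dpAlgorithm [NeZero n] (F : FiniteDistribution) :
    (ofDet (F.dpAlgorithm n)).IsOptimal F := fun B => by
  rw [expectedReward_ofDet, F.expectedReward_dpAlgorithm]
  exact B.expectedReward_le_dpValue F

end TestingAlgorithm

/-! ### Monotonicity and convexity of the value function. -/

namespace FiniteDistribution

variable (F : FiniteDistribution)

theorem dpValue_mono (k : ℕ) : Monotone (F.dpValue k) := by
  induction k with
  | zero => exact monotone_id
  | succ k ih =>
    intro V V' h
    rw [dpValue_succ]
    refine le_trans ?_ (F.stepValue_le_dpValue_succ k V' (F.dpTest k V))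
    exact Finset.sum_le_sum fun b _ => mul_le_mul_of_nonneg_left
      (ih (max_le_max_right _ h)) (F.testProb_nonneg _ _)

theorem max_mix_le {x y c l : ℝ} (h0 : 0 ≤ l) (h1 : l ≤ 1) :
    max (l * x + (1 - l) * y) c ≤ l * max x c + (1 - l) * max y c := by
  have h2 : 0 ≤ 1 - l := by linarith
  have hx := mul_le_mul_of_nonneg_left (le_max_left x c) h0
  have hx' := mul_le_mul_of_nonneg_left (le_max_right x c) h0
  have hy := mul_le_mul_of_nonneg_left (le_max_left y c) h2
  have hy' := mul_le_mul_of_nonneg_left (le_max_right y c) h2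
  exact max_le (by linarith) (by linarith)

/-- Maximum with a constant is convex, a monotone convex function of it stays convex, and so do
nonnegative mixtures and suprema. -/
theorem dpValue_convex (k : ℕ) {x y l : ℝ} (h0 : 0 ≤ l) (h1 : l ≤ 1) :
    F.dpValue k (l * x + (1 - l) * y) ≤ l * F.dpValue k x + (1 - l) * F.dpValue k y := by
  induction k generalizing x y with
  | zero => exact le_rfl
  | succ k ih =>
    rw [dpValue_succ]
    generalize F.dpTest k _ = j
    have h2 : 0 ≤ 1 - l := by linarith
    calc F.stepValue (F.dpValue k) (l * x + (1 - l) * y) j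
        ≤ l * F.stepValue (F.dpValue k) x j + (1 - l) * F.stepValue (F.dpValue k) y j := by
          rw [stepValue, stepValue, stepValue, Finset.mul_sum, Finset.mul_sum,
            ← Finset.sum_add_distrib]
          refine Finset.sum_le_sum fun b _ => ?_
          have := mul_le_mul_of_nonneg_left ((F.dpValue_mono k
            (max_mix_le (x := x) (y := y) (c := F.condExpectation (F.val j) b) h0 h1)).trans ih)
            (F.testProb_nonneg (F.val j) b)
          linarith
      _ ≤ _ := add_le_add
          (mul_le_mul_of_nonneg_left (F.stepValue_le_dpValue_succ k x j) h0)
          (mul_le_mul_of_nonneg_left (F.stepValue_le_dpValue_succ k y j) h2)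

theorem dpValue_le_succ (k : ℕ) (V : ℝ) : F.dpValue k V ≤ F.dpValue (k + 1) V := by
  rw [dpValue_succ, stepValue, Fintype.sum_bool]
  generalize F.dpTest k V = j
  have h : ∀ b, F.dpValue k V ≤ F.dpValue k (max V (F.condExpectation (F.val j) b)) := fun b =>
    F.dpValue_mono k (le_max_left _ _)
  have h1 := mul_le_mul_of_nonneg_left (h true) (F.testProb_nonneg (F.val j) true)
  have h2 := mul_le_mul_of_nonneg_left (h false) (F.testProb_nonneg (F.val j) false)
  have h3 := F.sum_testProb (F.val j)
  calc F.dpValue k V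
      = (F.testProb (F.val j) true + F.testProb (F.val j) false) * F.dpValue k V := by
        rw [h3, one_mul]
    _ ≤ _ := by linarith

theorem dpValue_mono_left (V : ℝ) : Monotone fun k => F.dpValue k V :=
  monotone_nat_of_le_succ fun k => F.dpValue_le_succ k V

/-! ### Tails, increments and tests at quantiles. -/

/-- `Pr[X ≥ v_k]`, and `0` if `k` is not an index. -/
def tail (k : ℕ) : ℝ := ∑ i : Fin F.m, if k ≤ (i : ℕ) then F.prob i else 0

theorem tail_zero : F.tail 0 = 1 := by simp [tail, F.sum_prob]

theorem tail_nonneg (k : ℕ) : 0 ≤ F.tail k :=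
  Finset.sum_nonneg fun i _ => by split_ifs <;> simp [(F.prob_pos i).le]

theorem tail_antitone : Antitone F.tail := fun k l h =>
  Finset.sum_le_sum fun i _ => by
    by_cases h1 : l ≤ (i : ℕ)
    · rw [if_pos h1, if_pos (h.trans h1)]
    · rw [if_neg h1]; split_ifs <;> simp [(F.prob_pos i).le]

theorem tail_le_one (k : ℕ) : F.tail k ≤ 1 := F.tail_zero ▸ F.tail_antitone (Nat.zero_le k)

theorem tail_eq_zero {k : ℕ} (h : F.m ≤ k) : F.tail k = 0 :=
  Finset.sum_eq_zero fun i _ => if_neg (by omega)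

/-- The differences of consecutive realizations (starting from `0`). -/
def increment (k : Fin F.m) : ℝ :=
  F.val k - if h : 0 < (k : ℕ) then (F.val ⟨k - 1, by omega⟩ : ℝ) else 0

theorem increment_nonneg (k : Fin F.m) : 0 ≤ F.increment k := by
  rw [increment, sub_nonneg]
  split_ifs with h
  · exact NNReal.coe_le_coe.2 (F.strictMono_val.monotone (Fin.le_def.2 (Nat.sub_le _ _)))
  · exact NNReal.coe_nonneg _

theorem val_eq_sum_increment (i : Fin F.m) :
    (F.val i : ℝ) = ∑ k, if k ≤ i then F.increment k else 0 := by
  -- The realizations shifted by one, with `u 0 = 0`, so that the increments telescope.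
  let u : ℕ → ℝ := fun k => if h : 0 < k ∧ k - 1 < F.m then (F.val ⟨k - 1, h.2⟩ : ℝ) else 0
  have hu : ∀ k : Fin F.m, F.increment k = u (k + 1) - u k := by
    intro k
    simp only [increment, u]
    have h1 : 0 < (k : ℕ) + 1 ∧ (k : ℕ) + 1 - 1 < F.m := by omega
    rw [dif_pos h1]
    congr 1
    by_cases h : 0 < (k : ℕ)
    · rw [dif_pos h, dif_pos ⟨h, by omega⟩]
    · rw [dif_neg h, dif_neg (by omega)]
  have h1 : (F.val i : ℝ) = ∑ k ∈ Finset.range (i + 1), (u (k + 1) - u k) := by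
    rw [Finset.sum_range_sub]
    simp [u]
  rw [h1]
  simp only [hu, Fin.le_def]
  rw [Fin.sum_univ_eq_sum_range (fun k => if k ≤ (i : ℕ) then u (k + 1) - u k else 0) F.m,
    ← Finset.sum_filter]
  refine Finset.sum_congr ?_ fun _ _ => rfl
  ext k
  simp only [Finset.mem_range, Finset.mem_filter]
  omega

/-- The contribution to the expectation of the values in the best `q`-quantile. -/
def quantileMass (q : ℝ) : ℝ := ∑ k : Fin F.m, F.increment k * min q (F.tail k)

theorem testProb_val_true (j : Fin F.m) : F.testProb (F.val j) true = F.tail j := by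
  simp [testProb, tail, F.strictMono_val.le_iff_le]

/-- Write each value as a sum of increments and exchange sums: increment `k` counts with the
probability that both `v_j` and `v_k` are reached, which is the smaller of the two tails. -/
theorem tail_mul_condExpectation (j : Fin F.m) :
    F.tail j * F.condExpectation (F.val j) true = F.quantileMass (F.tail j) := by
  rw [← testProb_val_true, testProb_mul_condExpectation, testProb_val_true, quantileMass]
  have h : ∀ k : Fin F.m, min (F.tail j) (F.tail k) =
      ∑ i, if j ≤ i ∧ k ≤ i then F.prob i else 0 := by
    intro k
    rcases le_total k j with hk | hk
    · rw [min_eq_left (F.tail_antitone hk), tail]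
      refine Finset.sum_congr rfl fun i _ => ?_
      have : (j : ℕ) ≤ i ↔ j ≤ i ∧ k ≤ i := ⟨fun h => ⟨h, hk.trans h⟩, fun h => h.1⟩
      simp only [this]
    · rw [min_eq_right (F.tail_antitone hk), tail]
      refine Finset.sum_congr rfl fun i _ => ?_
      have : (k : ℕ) ≤ i ↔ j ≤ i ∧ k ≤ i := ⟨fun h => ⟨hk.trans h, h⟩, fun h => h.2⟩
      simp only [this]
  simp only [h, Finset.mul_sum]
  rw [Finset.sum_comm]
  refine Finset.sum_congr rfl fun i _ => ?_
  rw [F.val_eq_sum_increment i, Finset.mul_sum]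
  by_cases hj : j ≤ i
  · simp only [F.strictMono_val.le_iff_le, hj, decide_true, if_true, true_and]
    exact Finset.sum_congr rfl fun k _ => by split_ifs <;> ring
  · simp [F.strictMono_val.le_iff_le, hj]

/-- Testing the next box for an atom, ignoring a negative result. -/
theorem tail_mix_le (k : ℕ) (V : ℝ) (j : ℕ) :
    F.tail j * F.dpValue k (max V (F.quantileMass (F.tail j) / F.tail j)) +
      (1 - F.tail j) * F.dpValue k V ≤ F.dpValue (k + 1) V := by
  by_cases hj : j < F.m
  · by_cases h0 : F.tail j = 0
    · rw [h0]
      simpa using F.dpValue_le_succ k V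
    · refine le_trans ?_ (F.stepValue_le_dpValue_succ k V ⟨j, hj⟩)
      have h1 := F.testProb_val_true ⟨j, hj⟩
      have h2 := F.tail_mul_condExpectation ⟨j, hj⟩
      have h3 := F.sum_testProb (F.val ⟨j, hj⟩)
      have h4 : F.dpValue k V ≤
          F.dpValue k (max V (F.condExpectation (F.val ⟨j, hj⟩) false)) :=
        F.dpValue_mono k (le_max_left _ _)
      rw [stepValue, Fintype.sum_bool, h1]
      dsimp only at h1 h2 ⊢
      rw [← h2, mul_div_cancel_left₀ _ h0, ← h1]
      have h5 := mul_le_mul_of_nonneg_left h4 (F.testProb_nonneg (F.val ⟨j, hj⟩) false)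
      have h6 : 1 - F.testProb (F.val ⟨j, hj⟩) true = F.testProb (F.val ⟨j, hj⟩) false := by
        linarith
      rw [h6]
      linarith
  · rw [F.tail_eq_zero (not_lt.1 hj)]
    simpa using F.dpValue_le_succ k V

/-- Testing the next box at an arbitrary quantile, by interpolation between two atoms. -/
theorem quantile_mix_le (k : ℕ) (V : ℝ) {q : ℝ} (h0 : 0 < q) (h1 : q ≤ 1) :
    q * F.dpValue k (max V (F.quantileMass q / q)) + (1 - q) * F.dpValue k V ≤
      F.dpValue (k + 1) V := by
  classical
  have hex : ∃ j, F.tail (j + 1) < q := ⟨F.m, by rwa [F.tail_eq_zero (Nat.le_succ _)]⟩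
  obtain ⟨j, hj, hj'⟩ : ∃ j, F.tail (j + 1) < q ∧ q ≤ F.tail j := by
    refine ⟨Nat.find hex, Nat.find_spec hex, ?_⟩
    rcases h : Nat.find hex with _ | i
    · rwa [tail_zero]
    · exact not_lt.1 (Nat.find_min hex (by omega))
  obtain ⟨l, hl0, hl1, hq⟩ : ∃ l : ℝ, 0 ≤ l ∧ l ≤ 1 ∧
      q = l * F.tail j + (1 - l) * F.tail (j + 1) := by
    have hd : 0 < F.tail j - F.tail (j + 1) := by linarith
    refine ⟨(q - F.tail (j + 1)) / (F.tail j - F.tail (j + 1)), ?_, ?_, ?_⟩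
    · exact div_nonneg (by linarith) hd.le
    · rw [div_le_one hd]; linarith
    · field_simp
      ring
  have hl2 : 0 ≤ 1 - l := by linarith
  set g := F.tail j with hg
  set g' := F.tail (j + 1) with hg'
  have hg0 : 0 < g := h0.trans_le hj'
  have hg'0 : 0 ≤ g' := F.tail_nonneg _
  -- No tail value lies strictly between `g'` and `g`, so every `min` is affine in the quantile
  -- there.
  have hM : F.quantileMass q = l * F.quantileMass g + (1 - l) * F.quantileMass g' := by
    simp only [quantileMass, Finset.mul_sum, ← Finset.sum_add_distrib]
    refine Finset.sum_congr rfl fun i _ => ?_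
    rcases le_or_gt (i : ℕ) j with hi | hi
    · have hi' : g ≤ F.tail i := F.tail_antitone hi
      rw [min_eq_left (hj'.trans hi'), min_eq_left hi',
        min_eq_left (hj.le.trans (hj'.trans hi'))]
      linear_combination F.increment i * hq
    · have hi' : F.tail i ≤ g' := F.tail_antitone hi
      rw [min_eq_right (hi'.trans hj.le), min_eq_right (hi'.trans (hj.le.trans hj')),
        min_eq_right hi']
      ring
  have hg'M : g' * (F.quantileMass g' / g') = F.quantileMass g' := by
    by_cases h : g' = 0
    · rw [h]
      simp [quantileMass, F.tail_nonneg]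
    · rw [mul_div_cancel₀ _ h]
  -- Randomize between the two atoms with weights `l` and `1 - l`. Given a success, `l * g / q` is
  -- the probability that the first test was used.
  have hmix : F.quantileMass q / q = l * g / q * (F.quantileMass g / g) +
      (1 - l * g / q) * (F.quantileMass g' / g') := by
    have e : 1 - l * g / q = (1 - l) * g' / q := by
      rw [eq_div_iff h0.ne', sub_mul, div_mul_cancel₀ _ h0.ne']
      linarith
    rw [e, hM, ← hg'M]
    field_simp
  have hw0 : 0 ≤ l * g / q := by positivity
  have hw1 : l * g / q ≤ 1 := by
    rw [div_le_one h0]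
    have := mul_nonneg hl2 hg'0
    linarith
  have hconv : F.dpValue k (max V (F.quantileMass q / q)) ≤
      l * g / q * F.dpValue k (max V (F.quantileMass g / g)) +
        (1 - l * g / q) * F.dpValue k (max V (F.quantileMass g' / g')) := by
    refine le_trans (F.dpValue_mono k ?_) (F.dpValue_convex k hw0 hw1)
    rw [hmix, max_comm V, max_comm V, max_comm V]
    exact max_mix_le hw0 hw1
  have s1 := mul_le_mul_of_nonneg_left (F.tail_mix_le k V j) hl0
  have s2 := mul_le_mul_of_nonneg_left (F.tail_mix_le k V (j + 1)) hl2
  rw [← hg] at s1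
  rw [← hg'] at s2
  have s3 := mul_le_mul_of_nonneg_left hconv h0.le
  have s4 : q * (l * g / q * F.dpValue k (max V (F.quantileMass g / g)) +
        (1 - l * g / q) * F.dpValue k (max V (F.quantileMass g' / g'))) =
      l * g * F.dpValue k (max V (F.quantileMass g / g)) +
        (q - l * g) * F.dpValue k (max V (F.quantileMass g' / g')) := by
    field_simp
  rw [s4] at s3
  have s5 : q - l * g = (1 - l) * g' := by linarith
  rw [s5] at s3
  have s6 : (1 - q) * F.dpValue k V = l * ((1 - g) * F.dpValue k V) +
      (1 - l) * ((1 - g') * F.dpValue k V) := by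
    rw [hq]; ring
  linarith

/-- Testing a block of boxes at the same quantile, until the first success. -/
theorem block_mix_le (k B : ℕ) (V : ℝ) {q p : ℝ} (h0 : 0 < q) (h1 : q ≤ 1)
    (hp : (1 - q) ^ B ≤ 1 - p) :
    p * F.dpValue k (max V (F.quantileMass q / q)) + (1 - p) * F.dpValue k V ≤
      F.dpValue (k + B) V := by
  set W := F.dpValue k (max V (F.quantileMass q / q)) with hW
  have hWV : F.dpValue k V ≤ W := F.dpValue_mono k (le_max_left _ _)
  -- With the exact failure probability this is an induction in which boxes left in the block after
  -- a success are wasted. As `W` is the better outcome, a smaller success probability `p` only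
  -- lowers the bound.
  have key : ∀ B : ℕ, (1 - (1 - q) ^ B) * W + (1 - q) ^ B * F.dpValue k V ≤
      F.dpValue (k + B) V := by
    intro B
    induction B with
    | zero => simp
    | succ B ih =>
      have s1 := F.quantile_mix_le (k + B) V h0 h1
      have s2 : W ≤ F.dpValue (k + B) (max V (F.quantileMass q / q)) :=
        F.dpValue_mono_left _ (Nat.le_add_right k B)
      have s3 := mul_le_mul_of_nonneg_left s2 h0.le
      have s4 := mul_le_mul_of_nonneg_left ih (sub_nonneg.2 h1)
      calc _ = q * W + (1 - q) * ((1 - (1 - q) ^ B) * W + (1 - q) ^ B * F.dpValue k V) := by ring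
        _ ≤ _ := by
          rw [← add_assoc]
          linarith
  have h2 := mul_le_mul_of_nonneg_right hp (sub_nonneg.2 hWV)
  linarith [key B]

/-! ### The expected maximum. -/

theorem expect_prod (n : ℕ) (g : Fin F.m → ℝ) :
    ∑ x : Fin n → Fin F.m, (∏ i, F.prob (x i)) * ∏ i, g (x i) = (∑ j, F.prob j * g j) ^ n := by
  simp only [← Finset.prod_mul_distrib]
  rw [Fintype.sum_pow]

/-- The maximum is the sum of the increments of all realizations reached by some box; by
independence, all `n` boxes miss `v_k` with probability `(1 - F.tail k) ^ n`. -/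
theorem expectedMax_eq (n : ℕ) :
    F.expectedMax n = ∑ k : Fin F.m, F.increment k * (1 - (1 - F.tail k) ^ n) := by
  have hmax : ∀ x : Fin n → Fin F.m,
      ((Finset.univ.sup fun i => F.val (x i) : ℝ≥0) : ℝ) =
        ∑ k, F.increment k * (1 - ∏ i, if k ≤ x i then (0 : ℝ) else 1) := by
    intro x
    rcases n with _ | n
    · simp
    · obtain ⟨i₀, hi₀⟩ := Finite.exists_max x
      have h1 : (Finset.univ.sup fun i => F.val (x i)) = F.val (x i₀) :=
        le_antisymm (Finset.sup_le fun i _ => F.strictMono_val.monotone (hi₀ i))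
          (Finset.le_sup (f := fun i => F.val (x i)) (Finset.mem_univ i₀))
      rw [h1, val_eq_sum_increment]
      refine Finset.sum_congr rfl fun k _ => ?_
      by_cases hk : k ≤ x i₀
      · have h0 : ∏ i, (if k ≤ x i then (0 : ℝ) else 1) = 0 :=
          Finset.prod_eq_zero (Finset.mem_univ i₀) (if_pos hk)
        rw [if_pos hk, h0]
        ring
      · rw [if_neg hk, Finset.prod_eq_one fun i _ => if_neg fun h => hk (h.trans (hi₀ i))]
        ring
  have hone : ∑ x : Fin n → Fin F.m, ∏ i, F.prob (x i) = 1 := by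
    have := F.expect_prod n fun _ => 1
    simpa [F.sum_prob] using this
  simp only [expectedMax, expect, hmax, Finset.mul_sum]
  rw [Finset.sum_comm]
  refine Finset.sum_congr rfl fun k _ => ?_
  have h2 := F.expect_prod n fun j => if k ≤ j then (0 : ℝ) else 1
  have h3 : ∑ j, F.prob j * (if k ≤ j then (0 : ℝ) else 1) = 1 - F.tail k := by
    rw [eq_sub_iff_add_eq, tail, ← Finset.sum_add_distrib]
    refine Eq.trans ?_ F.sum_prob
    refine Finset.sum_congr rfl fun j _ => ?_
    by_cases h : k ≤ j
    · simp [h, Fin.le_def.1 h]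
    · simp [h]
  rw [h3] at h2
  rw [← h2, mul_sub, mul_one, Finset.mul_sum, ← sub_eq_zero]
  have h4 : F.increment k = ∑ x : Fin n → Fin F.m, F.increment k * ∏ i, F.prob (x i) := by
    rw [← Finset.mul_sum, hone, mul_one]
  nth_rewrite 2 [h4]
  rw [← Finset.sum_sub_distrib, ← Finset.sum_sub_distrib]
  exact Finset.sum_eq_zero fun x _ => by ring

end FiniteDistribution

/-! ### Quantile strategies and the reduction to a single tail probability. -/

/-- A stage of a quantile strategy: the boxes of a block are tested at the quantile `first / n`,
and after a success all boxes of the later blocks are tested at the quantile `second / n`.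
The success probabilities are bounded from below by `p` and `s`. -/
structure Stage where
  first : ℝ
  second : ℝ
  p : ℝ
  s : ℝ

/-- The expected final payoff of a quantile strategy if a final success at the quantile `a / n`
is worth `R a`. -/
def score (R : ℝ → ℝ) : List Stage → ℝ
  | [] => 0
  | x :: l => x.p * ((1 - x.s) * R x.first + x.s * R x.second) + (1 - x.p) * score R l

/-- Parameters that are realized by blocks of `B` out of `n` boxes. -/
def Realizable (n B : ℕ) : List Stage → Prop
  | [] => True
  | x :: l => (0 < x.first ∧ x.first ≤ n ∧ 0 < x.second ∧ x.second ≤ n ∧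
      0 ≤ x.p ∧ x.p ≤ 1 ∧ 0 ≤ x.s ∧ x.s ≤ 1 ∧ (1 - x.first / n) ^ B ≤ 1 - x.p ∧
      (1 - x.second / n) ^ (B * l.length) ≤ 1 - x.s) ∧ Realizable n B l

theorem score_sum {ι : Type*} (t : Finset ι) (c : ι → ℝ) (R : ι → ℝ → ℝ) (l : List Stage) :
    score (fun q => ∑ k ∈ t, c k * R k q) l = ∑ k ∈ t, c k * score (R k) l := by
  induction l with
  | nil => simp [score]
  | cons x l ih =>
    simp only [score, ih, Finset.mul_sum, ← Finset.sum_add_distrib]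
    exact Finset.sum_congr rfl fun _ _ => by ring

namespace FiniteDistribution

variable (F : FiniteDistribution)

theorem quantileMass_div {n : ℕ} {q : ℝ} (hq : 0 < q) (hn : q ≤ n) :
    F.quantileMass (q / n) / (q / n) =
      ∑ k : Fin F.m, F.increment k * min 1 (n * F.tail k / q) := by
  have hn0 : (0 : ℝ) < n := hq.trans_le hn
  have h : 0 < q / n := div_pos hq hn0
  rw [quantileMass, Finset.sum_div]
  refine Finset.sum_congr rfl fun k _ => ?_
  rw [mul_div_assoc, ← min_div_div_right h.le, div_self h.ne']
  congr 2
  field_simp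

theorem score_le_dpValue {n B : ℕ} {l : List Stage} (hl : Realizable n B l) :
    score (fun q => ∑ k : Fin F.m, F.increment k * min 1 (n * F.tail k / q)) l ≤
      F.dpValue (B * l.length) 0 := by
  induction l with
  | nil => exact F.le_dpValue _ 0
  | cons x l ih =>
    obtain ⟨⟨ha, han, hb, hbn, hp0, hp1, hs0, hs1, hp, hs⟩, hl⟩ := hl
    have hn0 : (0 : ℝ) < n := ha.trans_le han
    have e1 := F.block_mix_le (B * l.length) B 0 (div_pos ha hn0) ((div_le_one hn0).2 han) hp
    -- After a success all later blocks act as one long block at the second quantile, with no box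
    -- left behind it.
    have e2 := F.block_mix_le 0 (B * l.length) (max 0 (F.quantileMass (x.first / n) /
      (x.first / n))) (div_pos hb hn0) ((div_le_one hn0).2 hbn) hs
    rw [F.quantileMass_div ha han] at e1 e2
    rw [F.quantileMass_div hb hbn] at e2
    rw [score, List.length_cons, Nat.mul_succ]
    refine le_trans ?_ e1
    refine add_le_add (mul_le_mul_of_nonneg_left ?_ hp0)
      (mul_le_mul_of_nonneg_left (ih hl) (by linarith))
    rw [Nat.zero_add] at e2
    refine le_trans ?_ e2
    simp only [dpValue]
    rw [add_comm]
    exact add_le_add (mul_le_mul_of_nonneg_left (le_max_right _ _) hs0)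
      (mul_le_mul_of_nonneg_left (le_max_right _ _) (by linarith))

/-- A quantile strategy that is good for all two-point distributions is good for all
distributions. -/
theorem mul_expectedMax_le_dpValue {n B : ℕ} {l : List Stage} (hl : Realizable n B l)
    (hB : B * l.length ≤ n) {c : ℝ}
    (hc : ∀ g : ℝ, 0 ≤ g → g ≤ 1 →
      c * (1 - (1 - g) ^ n) ≤ score (fun q => min 1 (n * g / q)) l) :
    c * F.expectedMax n ≤ F.dpValue n 0 := by
  refine le_trans ?_ ((F.score_le_dpValue hl).trans (F.dpValue_mono_left 0 hB))
  rw [score_sum, expectedMax_eq, Finset.mul_sum]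
  refine Finset.sum_le_sum fun k _ => ?_
  have := mul_le_mul_of_nonneg_left (hc _ (F.tail_nonneg k) (F.tail_le_one k))
    (F.increment_nonneg k)
  linarith

end FiniteDistribution

/-! ### Concavity of the score. -/

/-- The parameters of all stages are in the admissible range. -/
def Admissible (l : List Stage) : Prop :=
  ∀ x ∈ l, 0 < x.first ∧ 0 < x.second ∧ 0 ≤ x.p ∧ x.p ≤ 1 ∧ 0 ≤ x.s ∧ x.s ≤ 1

theorem score_mono {R R' : ℝ → ℝ} {l : List Stage} (hl : Admissible l)
    (h : ∀ q, 0 < q → R q ≤ R' q) : score R l ≤ score R' l := by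
  induction l with
  | nil => exact le_rfl
  | cons x l ih =>
    obtain ⟨ha, hb, hp0, hp1, hs0, hs1⟩ := hl x List.mem_cons_self
    have h1 := mul_le_mul_of_nonneg_left (h _ ha) (sub_nonneg.2 hs1)
    have h2 := mul_le_mul_of_nonneg_left (h _ hb) hs0
    exact add_le_add (mul_le_mul_of_nonneg_left (add_le_add h1 h2) hp0)
      (mul_le_mul_of_nonneg_left (ih fun y hy => hl y (List.mem_cons_of_mem _ hy))
        (sub_nonneg.2 hp1))

theorem score_mix (R R' : ℝ → ℝ) (u v : ℝ) (l : List Stage) :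
    score (fun q => u * R q + v * R' q) l = u * score R l + v * score R' l := by
  induction l with
  | nil => simp [score]
  | cons x l ih =>
    simp only [score, ih]
    ring

/-- The score of a quantile strategy for a two-point distribution. -/
def stepScore (l : List Stage) (θ : ℝ) : ℝ := score (fun q => min 1 (θ / q)) l

theorem stepScore_mono {l : List Stage} (hl : Admissible l) : Monotone (stepScore l) :=
  fun _ _ h => score_mono hl fun _ hq => min_le_min_left _ (div_le_div_of_nonneg_right h hq.le)

theorem concaveOn_stepScore {l : List Stage} (hl : Admissible l) :
    ConcaveOn ℝ Set.univ (stepScore l) := by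
  refine ⟨convex_univ, fun x _ y _ u v hu hv huv => ?_⟩
  simp only [stepScore, smul_eq_mul]
  rw [← score_mix]
  refine score_mono hl fun q hq => le_min ?_ ?_
  · have h1 := mul_le_mul_of_nonneg_left (min_le_left 1 (x / q)) hu
    have h2 := mul_le_mul_of_nonneg_left (min_le_left 1 (y / q)) hv
    linarith
  · have h1 := mul_le_mul_of_nonneg_left (min_le_right 1 (x / q)) hu
    have h2 := mul_le_mul_of_nonneg_left (min_le_right 1 (y / q)) hv
    rw [add_div, mul_div_assoc, mul_div_assoc]
    linarith

theorem line_le_stepScore {l : List Stage} (hl : Admissible l) {α β x y θ : ℝ}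
    (hx : α + β * x ≤ stepScore l x) (hy : α + β * y ≤ stepScore l y)
    (h1 : x ≤ θ) (h2 : θ ≤ y) : α + β * θ ≤ stepScore l θ := by
  rcases h1.eq_or_lt with rfl | h1
  · exact hx
  have hd : 0 < y - x := by linarith
  have hu : 0 ≤ (y - θ) / (y - x) := div_nonneg (by linarith) hd.le
  have hv : 0 ≤ (θ - x) / (y - x) := div_nonneg (by linarith) hd.le
  have huv : (y - θ) / (y - x) + (θ - x) / (y - x) = 1 := by
    rw [← add_div, div_eq_one_iff_eq hd.ne']; ring
  have hθ : (y - θ) / (y - x) * x + (θ - x) / (y - x) * y = θ := by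
    field_simp
    ring
  have := (concaveOn_stepScore hl).2 (Set.mem_univ x) (Set.mem_univ y) hu hv huv
  simp only [smul_eq_mul, hθ] at this
  refine le_trans (le_of_eq ?_) (le_trans (add_le_add (mul_le_mul_of_nonneg_left hx hu)
    (mul_le_mul_of_nonneg_left hy hv)) this)
  linear_combination (-α) * huv - β * hθ

/-! ### Many boxes: success probabilities and tangents. -/

theorem tendsto_natDiv_div (d : ℕ) :
    Tendsto (fun n : ℕ => ((n / d : ℕ) : ℝ) / n) atTop (𝓝 (1 / d)) := by
  have h := (tendsto_nat_floor_mul_div_atTop (R := ℝ) (a := 1 / d) (by positivity)).comp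
    tendsto_natCast_atTop_atTop
  refine h.congr fun n => ?_
  simp only [Function.comp]
  rw [one_div_mul_eq_div, Nat.floor_div_eq_div]

/-- The success probability of `k` blocks, each with a `d`-th part of the boxes. -/
theorem eventually_one_sub_div_pow_le (d k : ℕ) {a p : ℝ}
    (h : Real.exp (-(a * (k / d))) < 1 - p) :
    ∀ᶠ n : ℕ in atTop, (1 - a / n) ^ (n / d * k) ≤ 1 - p := by
  have ht : Tendsto (fun n : ℕ => Real.exp (-(a * (((n / d : ℕ) : ℝ) / n * k)))) atTop
      (𝓝 (Real.exp (-(a * (1 / d * k))))) :=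
    (Real.continuous_exp.tendsto _).comp (((tendsto_natDiv_div d).mul_const _).const_mul a).neg
  rw [one_div_mul_eq_div] at ht
  filter_upwards [ht.eventually_lt_const h, eventually_ge_atTop ⌈a⌉₊, eventually_gt_atTop 0]
    with n hn hna hn0
  have hn0' : (0 : ℝ) < n := Nat.cast_pos.2 hn0
  have h1 : a / n ≤ 1 := (div_le_one hn0').2 (Nat.ceil_le.1 hna)
  have h2 : 1 - a / n ≤ Real.exp (-(a / n)) := by
    have := Real.add_one_le_exp (-(a / n))
    linarith
  refine le_trans (pow_le_pow_left₀ (by linarith) h2 _) (le_trans (le_of_eq ?_) hn.le)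
  rw [← Real.exp_nat_mul]
  congr 1
  push_cast
  ring

theorem taylor_four_le_exp {x : ℝ} (hx : 0 ≤ x) :
    1 + x + x ^ 2 / 2 + x ^ 3 / 6 + x ^ 4 / 24 ≤ Real.exp x := by
  have := Real.sum_le_exp_of_nonneg hx 5
  simp only [Finset.sum_range_succ, Finset.sum_range_zero, Nat.factorial] at this
  norm_num at this
  exact this

/-- Turns an upper bound for `exp (-x)` into a rational inequality that `norm_num` can decide. -/
theorem exp_neg_lt_of_taylor {x y : ℝ} (hx : 0 ≤ x)
    (h : 1 < y * (1 + x + x ^ 2 / 2 + x ^ 3 / 6 + x ^ 4 / 24)) : Real.exp (-x) < y := by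
  have h0 : 0 < 1 + x + x ^ 2 / 2 + x ^ 3 / 6 + x ^ 4 / 24 := by positivity
  have hy : 0 < y := (pos_iff_pos_of_mul_pos (one_pos.trans h)).2 h0
  rw [Real.exp_neg, inv_lt_iff_one_lt_mul₀ (Real.exp_pos x)]
  exact h.trans_le (mul_le_mul_of_nonneg_left (taylor_four_le_exp hx) hy.le)

/-- A sufficient condition for parameters to be realized by blocks, each with a `d`-th part of the
boxes, if the number of boxes is large. -/
def AsymptoticallyRealizable (d : ℕ) : List Stage → Prop
  | [] => True
  | x :: l => (1 < (1 - x.p) * (1 + (x.first / d) + (x.first / d) ^ 2 / 2 +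
        (x.first / d) ^ 3 / 6 + (x.first / d) ^ 4 / 24) ∧
      (x.s = 0 ∨ 1 < (1 - x.s) * (1 + (x.second * (l.length / d)) +
        (x.second * (l.length / d)) ^ 2 / 2 + (x.second * (l.length / d)) ^ 3 / 6 +
        (x.second * (l.length / d)) ^ 4 / 24))) ∧ AsymptoticallyRealizable d l

theorem eventually_realizable {d : ℕ} {l : List Stage} (ha : Admissible l)
    (h : AsymptoticallyRealizable d l) : ∀ᶠ n : ℕ in atTop, Realizable n (n / d) l := by
  induction l with
  | nil => exact Eventually.of_forall fun _ => trivial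
  | cons x l ih =>
    obtain ⟨hf, hs, hp0, hp1, hs0, hs1⟩ := ha x List.mem_cons_self
    obtain ⟨⟨h1, h2⟩, h⟩ := h
    have e1 : ∀ᶠ n : ℕ in atTop, (1 - x.first / n) ^ (n / d * 1) ≤ 1 - x.p := by
      refine eventually_one_sub_div_pow_le d 1 ?_
      rw [Nat.cast_one, mul_one_div]
      exact exp_neg_lt_of_taylor (by positivity) h1
    have e2 : ∀ᶠ n : ℕ in atTop, (1 - x.second / n) ^ (n / d * l.length) ≤ 1 - x.s := by
      rcases h2 with h2 | h2
      · filter_upwards [eventually_ge_atTop ⌈x.second⌉₊] with n hn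
        have hn' := Nat.ceil_le.1 hn
        have hn0 := hs.trans_le hn'
        rw [h2, sub_zero]
        have := (div_le_one hn0).2 hn'
        have := div_pos hs hn0
        exact pow_le_one₀ (by linarith) (by linarith)
      · exact eventually_one_sub_div_pow_le d _ (exp_neg_lt_of_taylor (by positivity) h2)
    filter_upwards [e1, e2, ih (fun y hy => ha y (List.mem_cons_of_mem _ hy)) h,
      eventually_ge_atTop ⌈x.first⌉₊, eventually_ge_atTop ⌈x.second⌉₊] with n h1 h2 h3 h4 h5
    rw [mul_one] at h1
    exact ⟨⟨hf, Nat.ceil_le.1 h4, hs, Nat.ceil_le.1 h5, hp0, hp1, hs0, hs1, h1, h2⟩, h3⟩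

/-- An asymptotic version of a tangent to the exponential function, uniform in `g`. -/
theorem eventually_tangent_le {r t : ℝ} (hr : 0 ≤ r) (ht : 0 ≤ t) (h : r < Real.exp (-t)) :
    ∀ᶠ n : ℕ in atTop, ∀ g : ℝ, 0 ≤ g → g ≤ 1 → r * (1 + t - n * g) ≤ (1 - g) ^ n := by
  have hlim : Tendsto (fun n : ℕ => Real.exp (-t) * Real.exp (-(2 * (1 + t) ^ 2 / n))) atTop
      (𝓝 (Real.exp (-t) * Real.exp (-0))) :=
    ((Real.continuous_exp.tendsto _).comp
      (tendsto_const_div_atTop_nhds_zero_nat _).neg).const_mul _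
  rw [neg_zero, Real.exp_zero, mul_one] at hlim
  filter_upwards [hlim.eventually_const_lt h, eventually_ge_atTop ⌈2 * (1 + t)⌉₊] with n h1 h2 g
    hg0 hg1
  -- Where the tangent is not positive there is nothing to show. Elsewhere `g < (1 + t) / n`, so
  -- replacing `1 - g` by `exp (-(g + 2 * g ^ 2))` costs a factor tending to `1` uniformly in `g`,
  -- absorbed by the gap between `r` and `exp (-t)`.
  rcases le_or_gt (1 + t) (n * g) with hθ | hθ
  · exact (mul_nonpos_of_nonneg_of_nonpos hr (by linarith)).trans
      (pow_nonneg (by linarith) n)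
  have hn : 2 * (1 + t) ≤ n := Nat.ceil_le.1 h2
  have hn0 : (0 : ℝ) < n := by linarith
  have hg2 : g ≤ 1 / 2 := by
    by_contra hcon
    have := mul_lt_mul_of_pos_left (not_le.1 hcon) hn0
    linarith
  -- Uses `(1 - g) * (1 + g + 2 * g ^ 2) = 1 + g ^ 2 * (1 - 2 * g)`.
  have hexp : Real.exp (-(g + 2 * g ^ 2)) ≤ 1 - g := by
    rw [Real.exp_neg, inv_le_iff_one_le_mul₀ (Real.exp_pos _)]
    have h3 := mul_le_mul_of_nonneg_left (Real.add_one_le_exp (g + 2 * g ^ 2))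
      (sub_nonneg.2 hg1)
    have h4 := mul_nonneg (sq_nonneg g) (by linarith : (0 : ℝ) ≤ 1 - 2 * g)
    linarith
  have hsq : n * (2 * g ^ 2) ≤ 2 * (1 + t) ^ 2 / n := by
    rw [le_div_iff₀ hn0]
    have := pow_le_pow_left₀ (by positivity) hθ.le 2
    linarith
  calc r * (1 + t - n * g)
      ≤ Real.exp (-t) * Real.exp (-(2 * (1 + t) ^ 2 / n)) * Real.exp (t - n * g) := by
        refine mul_le_mul h1.le ?_ (by linarith) (by positivity)
        have := Real.add_one_le_exp (t - n * g)
        linarith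
    _ = Real.exp (-(n * g) - 2 * (1 + t) ^ 2 / n) := by
        rw [← Real.exp_add, ← Real.exp_add]
        congr 1
        ring
    _ ≤ Real.exp (n * -(g + 2 * g ^ 2)) := Real.exp_le_exp.2 (by linarith)
    _ = Real.exp (-(g + 2 * g ^ 2)) ^ n := Real.exp_nat_mul _ n
    _ ≤ (1 - g) ^ n := pow_le_pow_left₀ (Real.exp_pos _).le hexp n

theorem lt_exp_neg_one_div_twenty : (0.9512 : ℝ) < Real.exp (-(1 / 20)) := by
  refine lt_of_pow_lt_pow_left₀ 20 (Real.exp_pos _).le ?_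
  rw [← Real.exp_nat_mul]
  norm_num
  rw [Real.exp_neg, lt_inv_comm₀ (by norm_num) (Real.exp_pos 1)]
  exact Real.exp_one_lt_d9.trans (by norm_num)

theorem eventually_tangent_le_pow (j : ℕ) : ∀ᶠ n : ℕ in atTop, ∀ g : ℝ, 0 ≤ g → g ≤ 1 →
    (0.9512 : ℝ) ^ j * (1 + j / 20 - n * g) ≤ (1 - g) ^ n := by
  -- At `j = 0` there is no gap below `exp 0 = 1`, but Bernoulli's inequality holds for every `n`.
  rcases Nat.eq_zero_or_pos j with rfl | hj
  · refine Eventually.of_forall fun n g _ hg1 => ?_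
    have := one_add_mul_le_pow (a := -g) (by linarith) n
    simpa [sub_eq_add_neg] using this
  · refine eventually_tangent_le (by positivity) (by positivity) ?_
    have : (-(j / 20) : ℝ) = j * -(1 / 20) := by ring
    rw [this, Real.exp_nat_mul]
    exact pow_lt_pow_left₀ lt_exp_neg_one_div_twenty (by norm_num) hj.ne'

/-! ### The numerical strategy and its verification. -/

/-- A quantile strategy with twelve blocks. -/
def twelveBlocks : List Stage :=
  [⟨0.67, 0.05, 0.054, 0.044⟩, ⟨0.82, 0.08, 0.066, 0.064⟩, ⟨0.95, 0.15, 0.076, 0.106⟩,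
    ⟨1.28, 0.24, 0.101, 0.147⟩, ⟨1.38, 0.27, 0.108, 0.145⟩, ⟨1.88, 0.44, 0.145, 0.197⟩,
    ⟨1.71, 0.34, 0.132, 0.132⟩, ⟨2.42, 0.45, 0.182, 0.139⟩, ⟨2.39, 0.45, 0.180, 0.106⟩,
    ⟨3.15, 0.45, 0.230, 0.072⟩, ⟨4.12, 0.55, 0.290, 0.044⟩, ⟨4.45, 1.5, 0.309, 0⟩]

theorem admissible_twelveBlocks : Admissible twelveBlocks := by
  simp only [Admissible, twelveBlocks, List.forall_mem_cons]
  norm_num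

theorem asymptoticallyRealizable_twelveBlocks : AsymptoticallyRealizable 12 twelveBlocks := by
  simp only [AsymptoticallyRealizable, twelveBlocks, List.length_cons, List.length_nil]
  norm_num

theorem mul_le_stepScore_of_tangent {n j : ℕ} {g x y : ℝ}
    (ht : (0.9512 : ℝ) ^ j * (1 + j / 20 - n * g) ≤ (1 - g) ^ n)
    (hx : 0.869 * (1 - (0.9512 : ℝ) ^ j * (1 + j / 20 - x)) ≤ stepScore twelveBlocks x)
    (hy : 0.869 * (1 - (0.9512 : ℝ) ^ j * (1 + j / 20 - y)) ≤ stepScore twelveBlocks y)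
    (h1 : x ≤ n * g) (h2 : n * g ≤ y) :
    0.869 * (1 - (1 - g) ^ n) ≤ stepScore twelveBlocks (n * g) := by
  have := line_le_stepScore admissible_twelveBlocks
    (α := 0.869 * (1 - (0.9512 : ℝ) ^ j * (1 + j / 20))) (β := 0.869 * (0.9512 : ℝ) ^ j)
    (by linarith) (by linarith) h1 h2
  linarith

set_option maxHeartbeats 1000000 in
theorem mul_le_stepScore {n : ℕ} {g : ℝ} (hg0 : 0 ≤ g) (hg1 : g ≤ 1)
    (ht : ∀ j : ℕ, j < 77 → (0.9512 : ℝ) ^ j * (1 + j / 20 - n * g) ≤ (1 - g) ^ n) :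
    0.869 * (1 - (1 - g) ^ n) ≤ stepScore twelveBlocks (n * g) := by
  have h0 : 0 ≤ n * g := by positivity
  -- Each interval is paired with a tangent point `j / 20` inside it; the largest `j` is 76.
  rcases le_total (n * g) 0.05 with h1 | h1
  · refine mul_le_stepScore_of_tangent (ht 0 (by norm_num)) ?_ ?_ h0 h1 <;>
      norm_num [stepScore, score, twelveBlocks]
  rcases le_total (n * g) 0.15 with h2 | h2
  · refine mul_le_stepScore_of_tangent (ht 2 (by norm_num)) ?_ ?_ h1 h2 <;>
      norm_num [stepScore, score, twelveBlocks]
  rcases le_total (n * g) 0.27 with h3 | h3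
  · refine mul_le_stepScore_of_tangent (ht 4 (by norm_num)) ?_ ?_ h2 h3 <;>
      norm_num [stepScore, score, twelveBlocks]
  rcases le_total (n * g) 0.45 with h4 | h4
  · refine mul_le_stepScore_of_tangent (ht 7 (by norm_num)) ?_ ?_ h3 h4 <;>
      norm_num [stepScore, score, twelveBlocks]
  rcases le_total (n * g) 0.67 with h5 | h5
  · refine mul_le_stepScore_of_tangent (ht 11 (by norm_num)) ?_ ?_ h4 h5 <;>
      norm_num [stepScore, score, twelveBlocks]
  rcases le_total (n * g) 0.94 with h6 | h6
  · refine mul_le_stepScore_of_tangent (ht 16 (by norm_num)) ?_ ?_ h5 h6 <;>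
      norm_num [stepScore, score, twelveBlocks]
  rcases le_total (n * g) 1.29 with h7 | h7
  · refine mul_le_stepScore_of_tangent (ht 22 (by norm_num)) ?_ ?_ h6 h7 <;>
      norm_num [stepScore, score, twelveBlocks]
  rcases le_total (n * g) 1.73 with h8 | h8
  · refine mul_le_stepScore_of_tangent (ht 30 (by norm_num)) ?_ ?_ h7 h8 <;>
      norm_num [stepScore, score, twelveBlocks]
  rcases le_total (n * g) 2.31 with h9 | h9
  · refine mul_le_stepScore_of_tangent (ht 40 (by norm_num)) ?_ ?_ h8 h9 <;>
      norm_num [stepScore, score, twelveBlocks]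
  rcases le_total (n * g) 3.15 with h10 | h10
  · refine mul_le_stepScore_of_tangent (ht 54 (by norm_num)) ?_ ?_ h9 h10 <;>
      norm_num [stepScore, score, twelveBlocks]
  rcases le_total (n * g) 4.8 with h11 | h11
  · refine mul_le_stepScore_of_tangent (ht 76 (by norm_num)) ?_ ?_ h10 h11 <;>
      norm_num [stepScore, score, twelveBlocks]
  -- All quantile parameters are below `4.8`, so every minimum is `1` and the score is the
  -- probability of some success.
  have h12 : 0.869 ≤ stepScore twelveBlocks 4.8 := by
    norm_num [stepScore, score, twelveBlocks]
  have h13 : 0 ≤ (1 - g) ^ n := pow_nonneg (by linarith) n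
  linarith [stepScore_mono admissible_twelveBlocks h11]

theorem eventually_mul_expectedMax_le_dpValue :
    ∀ᶠ n : ℕ in atTop, ∀ F : FiniteDistribution, 0.869 * F.expectedMax n ≤ F.dpValue n 0 := by
  have ht : ∀ᶠ n : ℕ in atTop, ∀ j ∈ Finset.range 77, ∀ g : ℝ, 0 ≤ g → g ≤ 1 →
      (0.9512 : ℝ) ^ j * (1 + j / 20 - n * g) ≤ (1 - g) ^ n :=
    (Filter.eventually_all_finset _).2 fun j _ => eventually_tangent_le_pow j
  filter_upwards [ht, eventually_realizable admissible_twelveBlocks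
    asymptoticallyRealizable_twelveBlocks] with n h1 h2 F
  refine F.mul_expectedMax_le_dpValue h2 (Nat.div_mul_le_self n 12) fun g hg0 hg1 => ?_
  exact mul_le_stepScore hg0 hg1 fun j hj => h1 j (Finset.mem_range.2 hj) g hg0 hg1

end

end ThresholdTesting

theorem corollary7 :
    ∃ ε : ℕ → ℝ, Tendsto ε atTop (𝓝 0) ∧
      ∀ (n : ℕ) [NeZero n] (F : ThresholdTesting.FiniteDistribution),
        (ThresholdTesting.TestingAlgorithm.ofDet (F.dpAlgorithm n)).IsOptimal F ∧
        ∀ A : ThresholdTesting.TestingAlgorithm n, A.IsOptimal F →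
          A.IsCompetitive F (0.869 - ε n) := by
  obtain ⟨N, hN⟩ := eventually_atTop.1 ThresholdTesting.eventually_mul_expectedMax_le_dpValue
  -- For the finitely many `n < N` the guaranteed ratio is `0`, and nonnegativity of the table
  -- suffices.
  refine ⟨fun n => if N ≤ n then 0 else 0.869, ?_, fun n _ F =>
    ⟨ThresholdTesting.TestingAlgorithm.isOptimal_dpAlgorithm F, fun A hA => ?_⟩⟩
  · refine tendsto_const_nhds.congr' ?_
    filter_upwards [eventually_ge_atTop N] with n hn
    rw [if_pos hn]
  · have h : F.dpValue n 0 ≤ A.expectedReward F := by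
      have := hA (ThresholdTesting.TestingAlgorithm.ofDet (F.dpAlgorithm n))
      rwa [ThresholdTesting.TestingAlgorithm.expectedReward_ofDet,
        F.expectedReward_dpAlgorithm] at this
    refine le_trans ?_ h
    dsimp only
    split_ifs with hn
    · rw [sub_zero]
      exact hN n hn F
    · rw [sub_self, zero_mul]
      exact F.le_dpValue n 0
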